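/- Let $\Omega\subset\mathbb R^3$ be a smoothly bounded open set, i.e. $\Omega$ is bounded and near every boundary point $\Omega$ is the set $\{\rho<0\}$ for a $C^\infty$ function $\rho$ with nonvanishing differential. On the real Hilbert space $L^2(\Omega)^4$, whose elements are written $(p,\mathbf v)$ with $p\in L^2(\Omega)$ and $\mathbf v\in L^2(\Omega)^3$, consider the acoustic grad-div operator $$p(\nabla)(p,\mathbf v)=\bigl(-\nabla\cdot\mathbf v,\,-\nabla p\bigr)$$ with domain $C_0^\infty(\Omega)^4$. Let $H^1_0(\Omega)$ be the closure of $C_0^\infty(\Omega)$ in $H^1(\Omega)$, and let $H^1_{\rm div}(\Omega)$ be the space of those $\mathbf v\in L^2(\Omega)^3$ whose distributional divergence belongs to $L^2(\Omega)$. Then $p(\nabla)$ extends to an operator $P$ on $L^2(\Omega)^4$ with domain $$V=H^1_0(\Omega)\times H^1_{\rm div}(\Omega),$$ acting by $P(p,\mathbf v)=(-\nabla\cdot\mathbf v,-\nabla p)$ in the sense of distributions, such that $V$ is dense in $L^2(\Omega)^4$ and $P$ is skew-adjoint: $P^*=-P$, including equality of the domains of $P^*$ and $P$. -/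

import Mathlib

open MeasureTheory TopologicalSpace
open scoped Distributions LineDeriv ContDiff InnerProductSpace

noncomputable section

namespace Acoustics

/-- Euclidean space `ℝ³`. -/
abbrev E3 : Type := EuclideanSpace ℝ (Fin 3)

/-- The `j`-th standard basis vector of `ℝ³`. -/
abbrev basisVec (j : Fin 3) : E3 := EuclideanSpace.single j (1 : ℝ)

/-- `Ω` is smoothly bounded: it is bounded, and near each boundary point it is the set where
a smooth function with non-vanishing differential is negative. -/
def IsSmoothlyBounded (Ω : Opens E3) : Prop :=
  Bornology.IsBounded (Ω : Set E3) ∧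
    ∀ x ∈ frontier (Ω : Set E3), ∃ (U : Set E3) (ρ : E3 → ℝ),
      IsOpen U ∧ x ∈ U ∧ ContDiffOn ℝ ∞ ρ U ∧ (∀ y ∈ U, fderiv ℝ ρ y ≠ 0) ∧
        ∀ y ∈ U, (y ∈ Ω ↔ ρ y < 0)

/-- The real Hilbert space `L²(Ω)`, for Lebesgue measure. -/
abbrev L2 (Ω : Opens E3) : Type := Lp ℝ 2 ((volume : Measure E3).restrict (Ω : Set E3))

/-- The Hilbert space `L²(Ω)⁴` of states `u = (p, v₁, v₂, v₃)`; the pressure is `u 0` and the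
velocity components are `u j.succ`, `j : Fin 3`. -/
abbrev State (Ω : Opens E3) : Type := PiLp 2 (fun _ : Fin 4 => L2 Ω)

theorem testFunction_memLp {Ω : Opens E3} (φ : 𝓓(Ω, ℝ)) :
    MemLp φ 2 ((volume : Measure E3).restrict (Ω : Set E3)) :=
  (φ.continuous.memLp_of_hasCompactSupport φ.hasCompactSupport).restrict _

/-- The embedding of `C₀^∞(Ω)` (Mathlib's test functions `𝓓(Ω, ℝ)`) into `L²(Ω)`. -/
def toL2 (Ω : Opens E3) : 𝓓(Ω, ℝ) →ₗ[ℝ] L2 Ω where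
  toFun φ := (testFunction_memLp φ).toLp φ
  map_add' φ ψ := MemLp.toLp_add (testFunction_memLp φ) (testFunction_memLp ψ)
  map_smul' c φ := MemLp.toLp_const_smul c (testFunction_memLp φ)

/-- The partial derivative `∂/∂xⱼ` on `C₀^∞(Ω)`. -/
def partialDeriv (Ω : Opens E3) (j : Fin 3) : 𝓓(Ω, ℝ) →ₗ[ℝ] 𝓓(Ω, ℝ) where
  toFun φ := ∂_{basisVec j} φ
  map_add' φ ψ := LineDeriv.lineDerivOp_add (basisVec j) φ ψ
  map_smul' c φ := LineDeriv.lineDerivOp_smul (basisVec j) c φ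

/-- `g` is the gradient of `p` in the sense of distributions on `Ω`:
`∫_Ω p ∂ⱼφ = -∫_Ω gⱼ φ` for all `j` and all test functions `φ`. -/
def IsWeakGrad {Ω : Opens E3} (p : L2 Ω) (g : Fin 3 → L2 Ω) : Prop :=
  ∀ (j : Fin 3) (φ : 𝓓(Ω, ℝ)), ⟪p, toL2 Ω (partialDeriv Ω j φ)⟫_ℝ = -⟪g j, toL2 Ω φ⟫_ℝ

/-- `d` is the divergence of `v` in the sense of distributions on `Ω`:
`∑ⱼ ∫_Ω vⱼ ∂ⱼφ = -∫_Ω d φ` for all test functions `φ`. -/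
def IsWeakDiv {Ω : Opens E3} (v : Fin 3 → L2 Ω) (d : L2 Ω) : Prop :=
  ∀ φ : 𝓓(Ω, ℝ), ∑ j, ⟪v j, toL2 Ω (partialDeriv Ω j φ)⟫_ℝ = -⟪d, toL2 Ω φ⟫_ℝ

/-- `H¹(Ω)`, realised as the space of pairs `(p, ∇p)` with `p` and its weak gradient `∇p` in `L²`;
the topology induced by `L²(Ω) × L²(Ω)³` is that of the `H¹` norm. -/
def H1Graph (Ω : Opens E3) : Submodule ℝ (L2 Ω × (Fin 3 → L2 Ω)) where
  carrier := {x | IsWeakGrad x.1 x.2}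
  add_mem' {x y} hx hy := by
    intro j φ
    have h1 := hx j φ
    have h2 := hy j φ
    simp only [Prod.fst_add, Prod.snd_add, Pi.add_apply, inner_add_left]
    rw [h1, h2]
    ring
  zero_mem' := by
    intro j φ
    simp
  smul_mem' c x hx := by
    intro j φ
    have h1 := hx j φ
    simp only [Prod.smul_fst, Prod.smul_snd, Pi.smul_apply, real_inner_smul_left]
    rw [h1]
    ring

/-- The image of `C₀^∞(Ω)` under `φ ↦ (φ, ∇φ)`. -/
def testGraph (Ω : Opens E3) : Submodule ℝ (L2 Ω × (Fin 3 → L2 Ω)) :=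
  LinearMap.range ((toL2 Ω).prod (LinearMap.pi fun j => toL2 Ω ∘ₗ partialDeriv Ω j))

/-- `H¹₀(Ω)`: the closure of `C₀^∞(Ω)` in `H¹(Ω)`, as a subspace of `L²(Ω)`. -/
def H10 (Ω : Opens E3) : Submodule ℝ (L2 Ω) :=
  (H1Graph Ω ⊓ (testGraph Ω).topologicalClosure).map (LinearMap.fst ℝ _ _)

/-- `H¹_div(Ω)`: the `v ∈ L²(Ω)³` whose distributional divergence belongs to `L²(Ω)`. -/
def HDiv (Ω : Opens E3) : Submodule ℝ (Fin 3 → L2 Ω) where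
  carrier := {v | ∃ d : L2 Ω, IsWeakDiv v d}
  add_mem' {v w} hv hw := by
    obtain ⟨d, hd⟩ := hv
    obtain ⟨e, he⟩ := hw
    refine ⟨d + e, fun φ => ?_⟩
    simp only [Pi.add_apply, inner_add_left, Finset.sum_add_distrib]
    rw [hd φ, he φ]
    ring
  zero_mem' := ⟨0, fun φ => by simp⟩
  smul_mem' c v hv := by
    obtain ⟨d, hd⟩ := hv
    refine ⟨c • d, fun φ => ?_⟩
    simp only [Pi.smul_apply, real_inner_smul_left, ← Finset.mul_sum]
    rw [hd φ]
    ring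

/-- The space `V = H¹₀(Ω) × H¹_div(Ω)`, as a subspace of `L²(Ω)⁴`. -/
def V (Ω : Opens E3) : Submodule ℝ (State Ω) where
  carrier := {u | u 0 ∈ H10 Ω ∧ (fun j : Fin 3 => u j.succ) ∈ HDiv Ω}
  add_mem' hu hw := ⟨(H10 Ω).add_mem hu.1 hw.1, (HDiv Ω).add_mem hu.2 hw.2⟩
  zero_mem' := ⟨(H10 Ω).zero_mem, (HDiv Ω).zero_mem⟩
  smul_mem' c _ hu := ⟨(H10 Ω).smul_mem c hu.1, (HDiv Ω).smul_mem c hu.2⟩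

/-- The embedding of `C₀^∞(Ω)⁴` into `L²(Ω)⁴`. -/
def testState {Ω : Opens E3} (φ : Fin 4 → 𝓓(Ω, ℝ)) : State Ω :=
  WithLp.toLp 2 fun i => toL2 Ω (φ i)

/-- The acoustic grad-div operator `p(∇)` on `C₀^∞(Ω)⁴`:
`p(∇)(p, v) = (-∑ⱼ ∂ⱼvⱼ, -∂₁p, -∂₂p, -∂₃p)`. -/
def gradDiv {Ω : Opens E3} (φ : Fin 4 → 𝓓(Ω, ℝ)) : Fin 4 → 𝓓(Ω, ℝ) :=
  Fin.cons (-∑ j : Fin 3, partialDeriv Ω j (φ j.succ)) (fun j : Fin 3 => -partialDeriv Ω j (φ 0))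

/-- A densely defined operator `P` on a real Hilbert space is skew-adjoint if `P* = -P`,
including equality of the domains. -/
def IsSkewAdjoint {H : Type*} [NormedAddCommGroup H] [InnerProductSpace ℝ H] [CompleteSpace H]
    (P : H →ₗ.[ℝ] H) : Prop :=
  Dense (P.domain : Set H) ∧ P.adjoint = -P

end Acoustics

end

namespace Acoustics

variable {Ω : Opens E3}

/-! Let `G` be the closure in `L²(Ω) × L²(Ω)³` of the pairs `(φ, ∇φ)`, `φ` a test function. Weak
divergence is defined by pairing with such pairs, so Green's formula extends to `G` by continuity
(`IsWeakDiv.green`); applied twice, it makes `P` skew-symmetric. Conversely, the pairs `(d, v)` with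
`d = div v` are exactly the orthogonal complement of the pairs `(φ, ∇φ)`, so any `(q, b)` satisfying
Green's formula against all of them lies in `G` (`mem_topologicalClosure_of_green`). This puts the
pressure of an element of the adjoint domain in `H¹₀`. No boundary trace is needed. -/

theorem inner_toL2_right (f : L2 Ω) (φ : 𝓓(Ω, ℝ)) :
    ⟪f, toL2 Ω φ⟫_ℝ = ∫ x in (Ω : Set E3), φ x * f x := by
  rw [MeasureTheory.L2.inner_def]
  refine integral_congr_ae ?_
  filter_upwards [(testFunction_memLp φ).coeFn_toLp] with x hx
  rw [show (toL2 Ω φ : E3 → ℝ) x = φ x from hx]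
  simp

theorem inner_toL2_toL2 (φ ψ : 𝓓(Ω, ℝ)) : ⟪toL2 Ω φ, toL2 Ω ψ⟫_ℝ = ∫ x, φ x * ψ x := by
  have hsupp : ∀ x, x ∉ (Ω : Set E3) → φ x * ψ x = 0 := fun x hx => by
    rw [image_eq_zero_of_notMem_tsupport fun h => hx (φ.tsupport_subset h), zero_mul]
  rw [inner_toL2_right, ← setIntegral_eq_integral_of_forall_compl_eq_zero hsupp]
  refine integral_congr_ae ?_
  filter_upwards [(testFunction_memLp φ).coeFn_toLp] with x hx
  rw [show (toL2 Ω φ : E3 → ℝ) x = φ x from hx, mul_comm]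

theorem integrable_mul_testFunction (φ ψ : 𝓓(Ω, ℝ)) : Integrable fun x => φ x * ψ x :=
  (φ.continuous.mul ψ.continuous).integrable_of_hasCompactSupport φ.hasCompactSupport.mul_right

theorem partialDeriv_apply (j : Fin 3) (φ : 𝓓(Ω, ℝ)) (x : E3) :
    partialDeriv Ω j φ x = fderiv ℝ φ x (basisVec j) := by
  change TestFunction.lineDerivCLM ℝ (basisVec j) φ x = _
  rw [TestFunction.lineDerivCLM_eq_fderivCLM, TestFunction.fderivCLM_apply_of_le]
  simp

/-- Integration by parts for two test functions. -/
theorem inner_toL2_partialDeriv (j : Fin 3) (φ ψ : 𝓓(Ω, ℝ)) :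
    ⟪toL2 Ω φ, toL2 Ω (partialDeriv Ω j ψ)⟫_ℝ = -⟪toL2 Ω (partialDeriv Ω j φ), toL2 Ω ψ⟫_ℝ := by
  have h1 := integrable_mul_testFunction (partialDeriv Ω j φ) ψ
  have h2 := integrable_mul_testFunction φ (partialDeriv Ω j ψ)
  rw [inner_toL2_toL2, inner_toL2_toL2]
  simp only [partialDeriv_apply] at h1 h2 ⊢
  exact integral_mul_fderiv_eq_neg_fderiv_mul_of_integrable h1 h2
    (integrable_mul_testFunction φ ψ)
    (fun x _ => (φ.contDiff.differentiable (by simp)).differentiableAt)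
    (fun x _ => (ψ.contDiff.differentiable (by simp)).differentiableAt)

/-- The fundamental lemma of the calculus of variations in `L²(Ω)`. -/
theorem eq_zero_of_forall_inner_toL2 {f : L2 Ω} (h : ∀ φ, ⟪f, toL2 Ω φ⟫_ℝ = 0) : f = 0 := by
  rw [Lp.eq_zero_iff_ae_eq_zero]
  have hf : LocallyIntegrableOn f (Ω : Set E3) (volume : Measure E3) := by
    rw [locallyIntegrableOn_iff Ω.isOpen.isLocallyClosed]
    intro K hK hKc
    have h1 : IntegrableOn f K (volume.restrict (Ω : Set E3)) :=
      ((Lp.memLp f).locallyIntegrable (by norm_num)).integrableOn_isCompact hKc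
    rwa [IntegrableOn, Measure.restrict_restrict hKc.measurableSet,
      Set.inter_eq_left.mpr hK] at h1
  have h0 := Ω.isOpen.ae_eq_zero_of_integral_contDiff_smul_eq_zero hf fun g hg hc hs => by
    have h1 := h ⟨g, hg, hc, hs⟩
    rw [inner_toL2_right] at h1
    rw [← setIntegral_eq_integral_of_forall_compl_eq_zero (s := (Ω : Set E3)) fun x hx => by
      rw [image_eq_zero_of_notMem_tsupport fun h' => hx (hs h'), zero_smul]]
    exact h1
  exact (ae_restrict_iff' Ω.isOpen.measurableSet).mpr h0

theorem eq_of_forall_inner_toL2 {f g : L2 Ω} (h : ∀ φ, ⟪f, toL2 Ω φ⟫_ℝ = ⟪g, toL2 Ω φ⟫_ℝ) :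
    f = g :=
  sub_eq_zero.mp <| eq_zero_of_forall_inner_toL2 fun φ => by rw [inner_sub_left, h, sub_self]

theorem IsWeakGrad.unique {p : L2 Ω} {g g' : Fin 3 → L2 Ω} (h : IsWeakGrad p g)
    (h' : IsWeakGrad p g') : g = g' :=
  funext fun j => eq_of_forall_inner_toL2 fun φ => neg_injective <| by rw [← h j φ, h' j φ]

theorem IsWeakDiv.unique {v : Fin 3 → L2 Ω} {d d' : L2 Ω} (h : IsWeakDiv v d)
    (h' : IsWeakDiv v d') : d = d' :=
  eq_of_forall_inner_toL2 fun φ => neg_injective <| by rw [← h φ, h' φ]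

theorem inner_state (u w : State Ω) :
    ⟪u, w⟫_ℝ = ⟪u 0, w 0⟫_ℝ + ∑ j : Fin 3, ⟪u j.succ, w j.succ⟫_ℝ := by
  rw [PiLp.inner_apply, Fin.sum_univ_succ]

/-! ### Closure of the gradient and duality with the divergence -/

theorem mem_testGraph (φ : 𝓓(Ω, ℝ)) :
    (toL2 Ω φ, fun j => toL2 Ω (partialDeriv Ω j φ)) ∈ testGraph Ω :=
  ⟨φ, rfl⟩

/-- Green's formula between the closure of the gradient on test functions and the weak
divergence. -/
theorem IsWeakDiv.green {v : Fin 3 → L2 Ω} {d : L2 Ω} (h : IsWeakDiv v d)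
    {x : L2 Ω × (Fin 3 → L2 Ω)} (hx : x ∈ (testGraph Ω).topologicalClosure) :
    ⟪d, x.1⟫_ℝ + ∑ j, ⟪v j, x.2 j⟫_ℝ = 0 := by
  have hc : IsClosed {x : L2 Ω × (Fin 3 → L2 Ω) | ⟪d, x.1⟫_ℝ + ∑ j, ⟪v j, x.2 j⟫_ℝ = 0} :=
    isClosed_eq (by fun_prop) continuous_const
  refine closure_minimal ?_ hc hx
  rintro _ ⟨φ, rfl⟩
  have := h φ
  change ⟪d, toL2 Ω φ⟫_ℝ + ∑ j, ⟪v j, toL2 Ω (partialDeriv Ω j φ)⟫_ℝ = 0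
  rw [this, add_neg_cancel]

theorem isWeakDiv_single (j : Fin 3) (φ : 𝓓(Ω, ℝ)) :
    IsWeakDiv (Pi.single j (toL2 Ω φ)) (toL2 Ω (partialDeriv Ω j φ)) := by
  intro ψ
  rw [Finset.sum_eq_single j (fun i _ hi => by rw [Pi.single_eq_of_ne hi, inner_zero_left])
    (by simp), Pi.single_eq_same, inner_toL2_partialDeriv]

/-- Green's formula against the field `φ eⱼ`, whose divergence is `∂ⱼφ`, is the definition of the
weak gradient. -/
theorem testGraph_topologicalClosure_le : (testGraph Ω).topologicalClosure ≤ H1Graph Ω := by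
  intro x hx j φ
  have h := (isWeakDiv_single j φ).green hx
  rw [Finset.sum_eq_single j (fun i _ hi => by rw [Pi.single_eq_of_ne hi, inner_zero_left])
    (by simp), Pi.single_eq_same] at h
  rw [real_inner_comm, real_inner_comm (toL2 Ω φ)]
  linarith

theorem mem_H10_iff {q : L2 Ω} :
    q ∈ H10 Ω ↔ ∃ b, (q, b) ∈ (testGraph Ω).topologicalClosure := by
  constructor
  · rintro ⟨⟨q, b⟩, ⟨-, h⟩, rfl⟩
    exact ⟨b, h⟩
  · rintro ⟨b, h⟩
    exact ⟨(q, b), ⟨testGraph_topologicalClosure_le h, h⟩, rfl⟩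

theorem mem_topologicalClosure_of_isWeakGrad {q : L2 Ω} {b : Fin 3 → L2 Ω} (hq : q ∈ H10 Ω)
    (h : IsWeakGrad q b) : (q, b) ∈ (testGraph Ω).topologicalClosure := by
  obtain ⟨b', hb'⟩ := mem_H10_iff.mp hq
  obtain rfl := h.unique (testGraph_topologicalClosure_le hb')
  exact hb'

/-- A pair satisfying Green's formula against all of `H¹_div(Ω)` lies in the closure of the
gradient on test functions. -/
theorem mem_topologicalClosure_of_green {q : L2 Ω} {b : Fin 3 → L2 Ω}
    (h : ∀ v d, IsWeakDiv v d → ⟪d, q⟫_ℝ + ∑ j, ⟪v j, b j⟫_ℝ = 0) :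
    (q, b) ∈ (testGraph Ω).topologicalClosure := by
  -- The product `L² × (Fin 3 → L²)` carries a sup norm; moving to `State Ω` makes orthogonal
  -- complements available.
  let S : Submodule ℝ (State Ω) :=
    LinearMap.range ((WithLp.linearEquiv 2 ℝ (Fin 4 → L2 Ω)).symm.toLinearMap ∘ₗ
      LinearMap.pi (Fin.cons (toL2 Ω) fun j => toL2 Ω ∘ₗ partialDeriv Ω j))
  let w : State Ω := WithLp.toLp 2 (Fin.cons q b)
  have hw : w ∈ S.topologicalClosure := by
    rw [← Submodule.orthogonal_orthogonal_eq_closure, Submodule.mem_orthogonal]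
    intro u hu
    rw [Submodule.mem_orthogonal'] at hu
    rw [inner_state]
    refine h (fun j => u j.succ) (u 0) fun φ => ?_
    have := hu _ ⟨φ, rfl⟩
    rw [inner_state] at this
    exact eq_neg_of_add_eq_zero_right this
  have hcont : Continuous fun u : State Ω => (u 0, fun j : Fin 3 => u j.succ) := by fun_prop
  refine map_mem_closure (s := (S : Set (State Ω))) hcont hw ?_
  rintro _ ⟨φ, rfl⟩
  exact mem_testGraph φ

/-! ### The operator on `V` -/

/-- `w` is the value of the acoustic grad-div operator at `u` in the sense of distributions. -/
def IsWeakGradDiv (u w : State Ω) : Prop :=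
  IsWeakDiv (fun j : Fin 3 => u j.succ) (-(w 0)) ∧ IsWeakGrad (u 0) (fun j : Fin 3 => -(w j.succ))

theorem IsWeakGradDiv.unique {u w w' : State Ω} (h : IsWeakGradDiv u w)
    (h' : IsWeakGradDiv u w') : w = w' := by
  ext1 i
  refine Fin.cases (neg_injective (h.1.unique h'.1)) (fun j => neg_injective ?_) i
  exact congrFun (h.2.unique h'.2) j

theorem IsWeakGradDiv.add {u u' w w' : State Ω} (h : IsWeakGradDiv u w)
    (h' : IsWeakGradDiv u' w') : IsWeakGradDiv (u + u') (w + w') := by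
  constructor
  · intro φ
    have h1 := h.1 φ
    have h2 := h'.1 φ
    simp only [PiLp.add_apply, inner_add_left, inner_neg_left, Finset.sum_add_distrib] at *
    linarith
  · intro j φ
    have h1 := h.2 j φ
    have h2 := h'.2 j φ
    simp only [PiLp.add_apply, inner_add_left, inner_neg_left] at *
    linarith

theorem IsWeakGradDiv.smul {u w : State Ω} (c : ℝ) (h : IsWeakGradDiv u w) :
    IsWeakGradDiv (c • u) (c • w) := by
  constructor
  · intro φ
    have h1 := h.1 φ
    simp only [PiLp.smul_apply, real_inner_smul_left, inner_neg_left, ← Finset.mul_sum] at *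
    rw [h1]
    ring
  · intro j φ
    have h1 := h.2 j φ
    simp only [PiLp.smul_apply, real_inner_smul_left, inner_neg_left] at *
    rw [h1]
    ring

theorem exists_isWeakGradDiv (u : V Ω) : ∃ w, IsWeakGradDiv (u : State Ω) w := by
  obtain ⟨u, hp, d, hd⟩ := u
  obtain ⟨b, hb⟩ := mem_H10_iff.mp hp
  refine ⟨WithLp.toLp 2 (Fin.cons (-d) (-b)), ?_, ?_⟩
  · simpa using hd
  · have h := testGraph_topologicalClosure_le hb
    intro j φ
    simpa using h j φ

/-- The extension of the acoustic grad-div operator to `V = H¹₀(Ω) × H¹_div(Ω)`. -/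
noncomputable def gradDivExtension (Ω : Opens E3) : State Ω →ₗ.[ℝ] State Ω where
  domain := V Ω
  toFun :=
    -- The distributional value is unique, which makes the chosen one linear in `u`.
    { toFun := fun u => (exists_isWeakGradDiv u).choose
      map_add' := fun u u' => (exists_isWeakGradDiv (u + u')).choose_spec.unique
        ((exists_isWeakGradDiv u).choose_spec.add (exists_isWeakGradDiv u').choose_spec)
      map_smul' := fun c u => (exists_isWeakGradDiv (c • u)).choose_spec.unique
        ((exists_isWeakGradDiv u).choose_spec.smul c) }

theorem isWeakGradDiv_gradDivExtension (u : (gradDivExtension Ω).domain) :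
    IsWeakGradDiv (u : State Ω) (gradDivExtension Ω u) :=
  (exists_isWeakGradDiv u).choose_spec

theorem isWeakGradDiv_testState (φ : Fin 4 → 𝓓(Ω, ℝ)) :
    IsWeakGradDiv (testState φ) (testState (gradDiv φ)) := by
  constructor
  · intro ψ
    simp [testState, gradDiv, sum_inner, inner_toL2_partialDeriv]
  · intro j ψ
    simp [testState, gradDiv, inner_toL2_partialDeriv]

theorem testState_mem_V (φ : Fin 4 → 𝓓(Ω, ℝ)) : testState φ ∈ V Ω :=
  ⟨mem_H10_iff.mpr ⟨_, (testGraph Ω).le_topologicalClosure (mem_testGraph (φ 0))⟩,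
    _, (isWeakGradDiv_testState φ).1⟩

theorem gradDivExtension_testState (φ : Fin 4 → 𝓓(Ω, ℝ)) :
    gradDivExtension Ω ⟨testState φ, testState_mem_V φ⟩ = testState (gradDiv φ) :=
  (isWeakGradDiv_gradDivExtension _).unique (isWeakGradDiv_testState φ)

theorem inner_testState_single (w : State Ω) (i : Fin 4) (φ : 𝓓(Ω, ℝ)) :
    ⟪w, testState (Pi.single i φ)⟫_ℝ = ⟪w i, toL2 Ω φ⟫_ℝ := by
  rw [PiLp.inner_apply, Finset.sum_eq_single i]
  · simp [testState]
  · intro k _ hk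
    simp [testState, Pi.single_eq_of_ne hk]
  · simp

theorem dense_V (Ω : Opens E3) : Dense (V Ω : Set (State Ω)) := by
  rw [Submodule.dense_iff_topologicalClosure_eq_top, Submodule.topologicalClosure_eq_top_iff,
    Submodule.eq_bot_iff]
  intro w hw
  rw [Submodule.mem_orthogonal'] at hw
  ext1 i
  refine eq_zero_of_forall_inner_toL2 fun φ => ?_
  rw [← inner_testState_single]
  exact hw _ (testState_mem_V _)

/-! ### Skew-adjointness -/

theorem IsWeakGradDiv.inner_eq {u u' w w' : State Ω} (hu : u ∈ V Ω) (hu' : u' ∈ V Ω)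
    (h : IsWeakGradDiv u w) (h' : IsWeakGradDiv u' w') : ⟪-w, u'⟫_ℝ = ⟪u, w'⟫_ℝ := by
  have h1 := h.1.green (mem_topologicalClosure_of_isWeakGrad hu'.1 h'.2)
  have h2 := h'.1.green (mem_topologicalClosure_of_isWeakGrad hu.1 h.2)
  rw [inner_neg_left, inner_state, inner_state]
  simp only [inner_neg_left, inner_neg_right, Finset.sum_neg_distrib] at h1 h2
  simp only [real_inner_comm (u' _) _, real_inner_comm (w' 0) _] at *
  linarith

/-- Here `z` plays the role of `P* y`. States `(0, v)` control the pressure of `y`, and states `(φ,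
0)` its velocity. -/
theorem mem_V_of_inner_eq {y z : State Ω}
    (h : ∀ u : (gradDivExtension Ω).domain, ⟪z, (u : State Ω)⟫_ℝ = ⟪y, gradDivExtension Ω u⟫_ℝ) :
    y ∈ V Ω := by
  have hg : (y 0, fun j : Fin 3 => z j.succ) ∈ (testGraph Ω).topologicalClosure := by
    refine mem_topologicalClosure_of_green fun v d hd => ?_
    -- As `P(0, v) = (-div v, 0)`, the hypothesis becomes Green's formula for `y 0` with candidate
    -- gradient `z j.succ`.
    let u : State Ω := WithLp.toLp 2 (Fin.cons 0 v)
    let w : State Ω := WithLp.toLp 2 (Fin.cons (-d) 0)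
    have hu : u ∈ V Ω := ⟨(H10 Ω).zero_mem, d, hd⟩
    have hw : IsWeakGradDiv u w :=
      ⟨by simpa [u, w] using hd, fun j φ => by simp [u, w]⟩
    have h1 := h ⟨u, hu⟩
    rw [(isWeakGradDiv_gradDivExtension ⟨u, hu⟩).unique hw, inner_state, inner_state] at h1
    simp only [u, w, Fin.cons_zero, Fin.cons_succ, Pi.zero_apply, inner_zero_right,
      inner_neg_right, Finset.sum_const_zero, real_inner_comm d, zero_add, add_zero] at h1
    simp only [real_inner_comm _ (v _)]
    rw [real_inner_comm] at h1
    rw [h1]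
    simp [real_inner_comm]
  refine ⟨mem_H10_iff.mpr ⟨_, hg⟩, z 0, fun φ => ?_⟩
  -- Testing with `(φ, 0)` shows that the velocity of `y` has divergence `z 0`.
  have h1 := h ⟨_, testState_mem_V (Pi.single 0 φ)⟩
  rw [gradDivExtension_testState, inner_testState_single, inner_state] at h1
  simp [testState, gradDiv] at h1
  simp [h1]

theorem isSkewAdjoint_gradDivExtension (Ω : Opens E3) : IsSkewAdjoint (gradDivExtension Ω) := by
  have hdense : Dense ((gradDivExtension Ω).domain : Set (State Ω)) := dense_V Ω
  have key : ∀ y u : (gradDivExtension Ω).domain,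
      ⟪-gradDivExtension Ω y, (u : State Ω)⟫_ℝ = ⟪(y : State Ω), gradDivExtension Ω u⟫_ℝ :=
    fun y u => (isWeakGradDiv_gradDivExtension y).inner_eq y.2 u.2
      (isWeakGradDiv_gradDivExtension u)
  refine ⟨hdense, LinearPMap.ext (le_antisymm (fun y hy => ?_) fun y hy => ?_) ?_⟩
  · exact mem_V_of_inner_eq
      ((gradDivExtension Ω).adjoint_isFormalAdjoint hdense ⟨y, hy⟩)
  · exact LinearPMap.mem_adjoint_domain_of_exists y ⟨_, key ⟨y, hy⟩⟩
  · intro y hy hy'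
    exact LinearPMap.adjoint_apply_eq hdense ⟨y, hy⟩ (key ⟨y, hy'⟩)

end Acoustics

theorem mainTheorem11 (Ω : TopologicalSpace.Opens Acoustics.E3)
    (hΩ : Acoustics.IsSmoothlyBounded Ω) :
    ∃ P : Acoustics.State Ω →ₗ.[ℝ] Acoustics.State Ω,
      P.domain = Acoustics.V Ω ∧
      (∀ φ : Fin 4 → 𝓓(Ω, ℝ), ∃ h : Acoustics.testState φ ∈ P.domain,
        P ⟨Acoustics.testState φ, h⟩ = Acoustics.testState (Acoustics.gradDiv φ)) ∧
      (∀ u : P.domain,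
        Acoustics.IsWeakDiv (fun j : Fin 3 => (u : Acoustics.State Ω) j.succ) (-(P u 0)) ∧
        Acoustics.IsWeakGrad ((u : Acoustics.State Ω) 0) (fun j : Fin 3 => -(P u j.succ))) ∧
      Acoustics.IsSkewAdjoint P := by
  exact ⟨Acoustics.gradDivExtension Ω, rfl,
    fun φ => ⟨Acoustics.testState_mem_V φ, Acoustics.gradDivExtension_testState φ⟩,
    Acoustics.isWeakGradDiv_gradDivExtension, Acoustics.isSkewAdjoint_gradDivExtension Ω⟩
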